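/- Let $n\ge 0$ and $t\ge 1$ be integers, let $\mathbb R[\bar X]=\mathbb R[X_1,\dots,X_n]$, and let $A^*$ denote the transpose of a matrix $A$ over $\mathbb R$ or $\mathbb R[\bar X]$. A matrix is symmetric if $A=A^*$; a real symmetric matrix $A$ is positive semidefinite if $v^*Av\ge 0$ for all real vectors $v$, and negative semidefinite if $-A$ is positive semidefinite. Let $G$ be a (possibly infinite) set of symmetric matrix polynomials in $\mathbb R[\bar X]^{t\times t}$, and put $$S_G=\{x\in\mathbb R^n\mid g(x)\text{ is positive semidefinite for all } g\in G\},$$ $$M_G=\Big\{\sum_{i=1}^N p_i^*g_ip_i\ \Big|\ N\in\mathbb N,\ g_i\in\{1\}\cup G,\ p_i\in\mathbb R[\bar X]^{t\times t}\Big\},$$ where $1$ is the identity matrix. Suppose that $M_G$ is archimedean, that is, for every $a\in\mathbb R[\bar X]^{t\times t}$ there is a positive integer $N$ with $N\cdot 1-a^*a\in M_G$. Then for every symmetric $f\in\mathbb R[\bar X]^{t\times t}$ the following are equivalent: (i) for every $x\in S_G$, the matrix $f(x)$ is not negative semidefinite; (ii) there are finitely many $p_i\in\mathbb R[\bar X]^{t\times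 t}$ such that $\sum_i p_i^*fp_i\in 1+M_G$. -/

import Mathlib

/-- The ring `ℝ[X₁, …, Xₙ]^{t × t}` of real `t × t` matrix polynomials in `n` variables.
Since `ℝ[X₁, …, Xₙ]` carries the trivial involution, the involution `p ↦ p^*` of this ring is the
transposition `p ↦ pᵀ`. -/
abbrev MatPoly (n t : ℕ) : Type :=
  Matrix (Fin t) (Fin t) (MvPolynomial (Fin n) ℝ)

namespace MatPoly

/-- The value `f(x)`, a real `t × t` matrix, of a matrix polynomial `f` at a point `x` of `ℝⁿ`. -/
noncomputable def evalAt {n t : ℕ} (x : Fin n → ℝ) (f : MatPoly n t) :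
    Matrix (Fin t) (Fin t) ℝ :=
  f.map (MvPolynomial.eval x)

/-- The set `S_G` of all points at which every element of `G` is positive semidefinite. -/
def posSet {n t : ℕ} (G : Set (MatPoly n t)) : Set (Fin n → ℝ) :=
  {x | ∀ g ∈ G, (evalAt x g).PosSemidef}

/-- The quadratic module `M_G` generated by `G`: all finite sums `∑ᵢ pᵢ^* gᵢ pᵢ` with
`gᵢ ∈ {1} ∪ G` and arbitrary matrix polynomials `pᵢ`. -/
def quadraticModule {n t : ℕ} (G : Set (MatPoly n t)) : Set (MatPoly n t) :=
  {q | ∃ (N : ℕ) (g p : Fin N → MatPoly n t),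
    (∀ i, g i ∈ insert 1 G) ∧ q = ∑ i, (p i).transpose * g i * p i}

/-- `M` is archimedean: for every matrix polynomial `a` there is a positive integer `N` with
`N - a^* a ∈ M`. -/
def IsArchimedean {n t : ℕ} (M : Set (MatPoly n t)) : Prop :=
  ∀ a : MatPoly n t, ∃ N : ℕ, 0 < N ∧ (N : MatPoly n t) - a.transpose * a ∈ M

end MatPoly

/-- A real square matrix `A` is negative semidefinite if `-A` is positive semidefinite. -/
def Matrix.IsNegSemidef {t : ℕ} (A : Matrix (Fin t) (Fin t) ℝ) : Prop :=
  (-A).PosSemidef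

/-! Adjoining `-f` to `G` turns (i) into emptiness of the positivity set. It then suffices that an
archimedean `M_G` with empty positivity set contains `-1`, since moving the `-f` terms to the other
side gives (ii). That claim reduces to the commutative case: the scalar matrices in `M_G` form an
archimedean quadratic module of `ℝ[X]` containing every `v^* g v`. If it is proper, a maximal proper
quadratic module above it is total, and every polynomial is a real number up to infinitesimals. The
values of the `X i` give a point where the module is nonnegative (`exists_eval_nonneg`); constant
`v` put it in the positivity set. The converse is evaluation at a point. -/

/-- A quadratic module of a commutative ring. -/
structure IsQuadraticModule {A : Type*} [CommRing A] (Q : Set A) : Prop where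
  one_mem : 1 ∈ Q
  add_mem : ∀ {a b}, a ∈ Q → b ∈ Q → a + b ∈ Q
  sq_mul_mem : ∀ (c : A) {a}, a ∈ Q → c * c * a ∈ Q

/-! ### Quadratic modules in commutative rings -/

namespace IsQuadraticModule

section CommRing

variable {A : Type*} [CommRing A] {Q : Set A}

theorem zero_mem (hQ : IsQuadraticModule Q) : (0 : A) ∈ Q := by
  simpa using hQ.sq_mul_mem 0 hQ.one_mem

theorem isSumSq_mul_mem (hQ : IsQuadraticModule Q) {s a : A} (hs : IsSumSq s) (ha : a ∈ Q) :
    s * a ∈ Q := by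
  induction hs with
  | zero => simpa using hQ.zero_mem
  | sq_add c _ ih => rw [add_mul]; exact hQ.add_mem (hQ.sq_mul_mem c ha) ih

theorem isSumSq_mem (hQ : IsQuadraticModule Q) {s : A} (hs : IsSumSq s) : s ∈ Q := by
  simpa using hQ.isSumSq_mul_mem hs hQ.one_mem

/-- The quadratic module generated by a quadratic module and one further element. -/
theorem adjoin (hQ : IsQuadraticModule Q) (a : A) :
    IsQuadraticModule {b | ∃ q ∈ Q, ∃ s, IsSumSq s ∧ b = q + s * a} where
  one_mem := ⟨1, hQ.one_mem, 0, IsSumSq.zero, by ring⟩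
  add_mem := by
    rintro _ _ ⟨q, hq, s, hs, rfl⟩ ⟨q', hq', s', hs', rfl⟩
    exact ⟨q + q', hQ.add_mem hq hq', s + s', hs.add hs', by ring⟩
  sq_mul_mem := by
    rintro c _ ⟨q, hq, s, hs, rfl⟩
    exact ⟨c * c * q, hQ.sq_mul_mem c hq, c * c * s, (IsSumSq.mul_self c).mul hs, by ring⟩

theorem exists_maximal (hQ : IsQuadraticModule Q) (h : (-1 : A) ∉ Q) :
    ∃ P, Q ⊆ P ∧ Maximal (fun P : Set A => IsQuadraticModule P ∧ (-1 : A) ∉ P) P := by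
  refine zorn_subset_nonempty {P : Set A | IsQuadraticModule P ∧ (-1 : A) ∉ P} ?_ Q ⟨hQ, h⟩
  intro c hc hchain hne
  refine ⟨⋃₀ c, ⟨⟨?_, ?_, ?_⟩, ?_⟩, fun s hs => Set.subset_sUnion_of_mem hs⟩
  · obtain ⟨P, hP⟩ := hne
    exact ⟨P, hP, (hc hP).1.one_mem⟩
  · rintro a b ⟨P, hP, ha⟩ ⟨P', hP', hb⟩
    rcases hchain.total hP hP' with hle | hle
    · exact ⟨P', hP', (hc hP').1.add_mem (hle ha) hb⟩
    · exact ⟨P, hP, (hc hP).1.add_mem ha (hle hb)⟩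
  · rintro d a ⟨P, hP, ha⟩
    exact ⟨P, hP, (hc hP).1.sq_mul_mem d ha⟩
  · rintro ⟨P, hP, ha⟩
    exact (hc hP).2 ha

end CommRing

section Algebra

variable {A : Type*} [CommRing A] [Algebra ℝ A] {Q : Set A}

theorem algebraMap_mul_mem (hQ : IsQuadraticModule Q) {r : ℝ} (hr : 0 ≤ r) {a : A} (ha : a ∈ Q) :
    algebraMap ℝ A r * a ∈ Q := by
  have := hQ.sq_mul_mem (algebraMap ℝ A (Real.sqrt r)) ha
  rwa [← map_mul, Real.mul_self_sqrt hr] at this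

theorem algebraMap_mem (hQ : IsQuadraticModule Q) {r : ℝ} (hr : 0 ≤ r) :
    algebraMap ℝ A r ∈ Q := by
  simpa using hQ.algebraMap_mul_mem hr hQ.one_mem

/-- The support `Q ∩ -Q` of a quadratic module absorbs multiplication. -/
theorem mul_mem_of_neg_mem (hQ : IsQuadraticModule Q) {s : A} (hs : s ∈ Q) (hs' : -s ∈ Q)
    (a : A) : s * a ∈ Q := by
  -- `4sa = (a+1)²s + (a-1)²(-s)`.
  have h := hQ.algebraMap_mul_mem (r := 1 / 4) (by norm_num)
    (hQ.add_mem (hQ.sq_mul_mem (a + 1) hs) (hQ.sq_mul_mem (a - 1) hs'))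
  have h4 : algebraMap ℝ A (1 / 4) * 4 = 1 := by
    rw [← map_ofNat (algebraMap ℝ A) 4, ← map_mul]; norm_num
  convert h using 1
  linear_combination (-(s * a)) * h4

/-- If both fail, `-1 = q₁ + s₁a = q₂ - s₂a`. Eliminating `a` gives `-s₁ = s₂ + s₁q₂ + s₂q₁ ∈ Q`, so
`s₁` lies in the support, hence `s₁a ∈ Q` and `-1 ∈ Q`. -/
theorem mem_or_neg_mem_of_maximal
    (hQ : Maximal (fun P : Set A => IsQuadraticModule P ∧ (-1 : A) ∉ P) Q) (a : A) :
    a ∈ Q ∨ -a ∈ Q := by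
  obtain ⟨hQm, hQ1⟩ := hQ.prop
  have key : ∀ b, b ∉ Q → ∃ q ∈ Q, ∃ s, IsSumSq s ∧ -1 = q + s * b := by
    intro b hb
    by_contra hcon
    have hsub : Q ⊆ {c | ∃ q ∈ Q, ∃ s, IsSumSq s ∧ c = q + s * b} :=
      fun q hq => ⟨q, hq, 0, IsSumSq.zero, by ring⟩
    exact hb (hQ.le_of_ge ⟨hQm.adjoin b, hcon⟩ hsub
      ⟨0, hQm.zero_mem, 1, by simp, by ring⟩)
  by_contra! hcon
  obtain ⟨q₁, hq₁, s₁, hs₁, h₁⟩ := key a hcon.1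
  obtain ⟨q₂, hq₂, s₂, hs₂, h₂⟩ := key (-a) hcon.2
  have hneg : -s₁ ∈ Q := by
    have := hQm.add_mem (hQm.isSumSq_mem hs₂)
      (hQm.add_mem (hQm.isSumSq_mul_mem hs₁ hq₂) (hQm.isSumSq_mul_mem hs₂ hq₁))
    convert this using 1
    linear_combination s₁ * h₂ + s₂ * h₁
  exact hQ1 (h₁ ▸ hQm.add_mem hq₁ (hQm.mul_mem_of_neg_mem (hQm.isSumSq_mem hs₁) hneg a))

theorem algebraMap_notMem (hQ : IsQuadraticModule Q) (h : (-1 : A) ∉ Q) {r : ℝ} (hr : r < 0) :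
    algebraMap ℝ A r ∉ Q := by
  intro hmem
  apply h
  have := hQ.algebraMap_mul_mem (r := -r⁻¹) (by simpa using hr.le) hmem
  rwa [← map_mul, neg_mul, inv_mul_cancel₀ hr.ne, map_neg, map_one] at this

end Algebra

end IsQuadraticModule

/-! ### Infinitesimals and real values -/

/-- `a` is infinitesimal with respect to `Q`: `-ε ≤ a ≤ ε` modulo `Q` for all real `ε > 0`. -/
def IsInfinitesimalMod {A : Type*} [CommRing A] [Algebra ℝ A] (Q : Set A) (a : A) : Prop :=
  ∀ ε : ℝ, 0 < ε → algebraMap ℝ A ε - a ∈ Q ∧ algebraMap ℝ A ε + a ∈ Q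

namespace IsInfinitesimalMod

variable {A : Type*} [CommRing A] [Algebra ℝ A] {Q : Set A}

theorem add (hQ : IsQuadraticModule Q) {a b : A} (ha : IsInfinitesimalMod Q a)
    (hb : IsInfinitesimalMod Q b) : IsInfinitesimalMod Q (a + b) := by
  intro ε hε
  obtain ⟨h₁, h₂⟩ := ha (ε / 2) (by linarith)
  obtain ⟨h₃, h₄⟩ := hb (ε / 2) (by linarith)
  have he : algebraMap ℝ A ε = algebraMap ℝ A (ε / 2) + algebraMap ℝ A (ε / 2) := by
    rw [← map_add, add_halves]
  constructor
  · convert hQ.add_mem h₁ h₃ using 1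
    linear_combination he
  · convert hQ.add_mem h₂ h₄ using 1
    linear_combination he

/-- `2ε(ε²-a²) = (ε-a)²(ε+a) + (ε+a)²(ε-a)`. -/
theorem sub_mul_self_mem (hQ : IsQuadraticModule Q) {a : A} (ha : IsInfinitesimalMod Q a)
    {ε : ℝ} (hε : 0 < ε) : algebraMap ℝ A (ε * ε) - a * a ∈ Q := by
  obtain ⟨h₁, h₂⟩ := ha ε hε
  have h := hQ.algebraMap_mul_mem (r := (2 * ε)⁻¹) (by positivity)
    (hQ.add_mem (hQ.sq_mul_mem (algebraMap ℝ A ε - a) h₂)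
      (hQ.sq_mul_mem (algebraMap ℝ A ε + a) h₁))
  have hinv : algebraMap ℝ A (2 * ε)⁻¹ * (2 * algebraMap ℝ A ε) = 1 := by
    rw [← map_ofNat (algebraMap ℝ A) 2, ← map_mul, ← map_mul, inv_mul_cancel₀ (by positivity),
      map_one]
  convert h using 1
  rw [map_mul]
  linear_combination (-(algebraMap ℝ A ε * algebraMap ℝ A ε - a * a)) * hinv

theorem mul (hQ : IsQuadraticModule Q)
    (harch : ∀ a : A, ∃ N : ℕ, 0 < N ∧ (N : A) - a * a ∈ Q) {a : A}
    (ha : IsInfinitesimalMod Q a) (b : A) : IsInfinitesimalMod Q (b * a) := by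
  obtain ⟨N, hN, hb⟩ := harch b
  have key : ∀ ε : ℝ, 0 < ε → ∀ b : A, (N : A) - b * b ∈ Q →
      algebraMap ℝ A ε - b * a ∈ Q := by
    intro ε hε b hb
    have hN' : (0 : ℝ) < N := by exact_mod_cast hN
    -- `2 (ε - b a) = u (N - b²) + u⁻¹ (u ε - a²) + u⁻¹ (a - u b)²` with `u = ε / N`
    set u : ℝ := ε / N with hu
    have hu0 : 0 < u := by positivity
    have hs := ha.sub_mul_self_mem hQ (ε := Real.sqrt (u * ε)) (by positivity)
    rw [Real.mul_self_sqrt (by positivity)] at hs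
    have h := hQ.algebraMap_mul_mem (r := 1 / 2) (by norm_num)
      (hQ.add_mem (hQ.add_mem (hQ.algebraMap_mul_mem hu0.le hb)
        (hQ.algebraMap_mul_mem (inv_nonneg.2 hu0.le) hs))
        (hQ.algebraMap_mul_mem (inv_nonneg.2 hu0.le)
          (hQ.sq_mul_mem (a - algebraMap ℝ A u * b) hQ.one_mem)))
    have h2 : algebraMap ℝ A (1 / 2) * 2 = 1 := by
      rw [← map_ofNat (algebraMap ℝ A) 2, ← map_mul]; norm_num
    have hinv : algebraMap ℝ A u⁻¹ * algebraMap ℝ A u = 1 := by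
      rw [← map_mul, inv_mul_cancel₀ hu0.ne', map_one]
    have huN : algebraMap ℝ A u * (N : A) = algebraMap ℝ A ε := by
      rw [← map_natCast (algebraMap ℝ A) N, ← map_mul, hu, div_mul_cancel₀ _ hN'.ne']
    convert h using 1
    rw [map_mul]
    generalize algebraMap ℝ A u⁻¹ = v at *
    generalize algebraMap ℝ A u = w at *
    generalize algebraMap ℝ A (1 / 2) = d at *
    generalize algebraMap ℝ A ε = e at *
    linear_combination (-(e - b * a)) * h2 - d * huN - d * (e - 2 * a * b + w * b * b) * hinv
  intro ε hε
  refine ⟨key ε hε b hb, ?_⟩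
  have := key ε hε (-b) (by simpa using hb)
  simpa using this

end IsInfinitesimalMod

namespace IsQuadraticModule

variable {A : Type*} [CommRing A] [Algebra ℝ A] {Q : Set A}

theorem exists_sub_mem (hQ : IsQuadraticModule Q)
    (harch : ∀ a : A, ∃ N : ℕ, 0 < N ∧ (N : A) - a * a ∈ Q) (a : A) :
    ∃ r : ℝ, algebraMap ℝ A r - a ∈ Q := by
  obtain ⟨N, -, hN⟩ := harch a
  -- `N + 1/4 - a = (N - a²) + (a - 1/2)²`.
  refine ⟨N + 1 / 4, ?_⟩
  have h2 : algebraMap ℝ A (1 / 2) * 2 = 1 := by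
    rw [← map_ofNat (algebraMap ℝ A) 2, ← map_mul]; norm_num
  have h4 : algebraMap ℝ A (1 / 4) = algebraMap ℝ A (1 / 2) * algebraMap ℝ A (1 / 2) := by
    rw [← map_mul]; norm_num
  convert hQ.add_mem hN (hQ.sq_mul_mem (a - algebraMap ℝ A (1 / 2)) hQ.one_mem) using 1
  rw [map_add, map_natCast]
  linear_combination h4 + a * h2

/-- Modulo the infinitesimals, every element is a real number. -/
theorem exists_isInfinitesimalMod_sub (hQ : IsQuadraticModule Q) (h1 : (-1 : A) ∉ Q)
    (htot : ∀ a, a ∈ Q ∨ -a ∈ Q)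
    (harch : ∀ a : A, ∃ N : ℕ, 0 < N ∧ (N : A) - a * a ∈ Q) (a : A) :
    ∃ r : ℝ, IsInfinitesimalMod Q (a - algebraMap ℝ A r) := by
  -- The real value of `a` is the infimum of its upper bounds modulo `Q`; totality makes every
  -- number below it a lower bound.
  set S : Set ℝ := {r | algebraMap ℝ A r - a ∈ Q} with hS
  have hne : S.Nonempty := hQ.exists_sub_mem harch a
  have hbdd : BddBelow S := by
    obtain ⟨m, hm⟩ := hQ.exists_sub_mem harch (-a)
    refine ⟨-m, fun r hr => ?_⟩
    by_contra! hlt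
    refine hQ.algebraMap_notMem h1 (r := r + m) (by linarith) ?_
    convert hQ.add_mem hr hm using 1
    rw [map_add]; ring
  refine ⟨sInf S, fun ε hε => ⟨?_, ?_⟩⟩
  · obtain ⟨r, hr, hlt⟩ := exists_lt_of_csInf_lt hne (lt_add_of_pos_right (sInf S) hε)
    convert hQ.add_mem hr (hQ.algebraMap_mem (r := sInf S + ε - r) (by linarith)) using 1
    rw [map_sub, map_add]; ring
  · rcases htot (algebraMap ℝ A (sInf S - ε) - a) with h | h
    · have := csInf_le hbdd h
      linarith
    · convert h using 1
      rw [map_sub]; ring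

end IsQuadraticModule

open MvPolynomial in
/-- An archimedean proper quadratic module of a real polynomial ring is nonnegative at some
point. -/
theorem IsQuadraticModule.exists_eval_nonneg {σ : Type*} {Q : Set (MvPolynomial σ ℝ)}
    (hQ : IsQuadraticModule Q) (h1 : (-1 : MvPolynomial σ ℝ) ∉ Q)
    (harch : ∀ a : MvPolynomial σ ℝ, ∃ N : ℕ, 0 < N ∧ (N : MvPolynomial σ ℝ) - a * a ∈ Q) :
    ∃ x : σ → ℝ, ∀ q ∈ Q, 0 ≤ eval x q := by
  obtain ⟨P, hQP, hP⟩ := hQ.exists_maximal h1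
  obtain ⟨hPm, hP1⟩ := hP.prop
  have harchP : ∀ a : MvPolynomial σ ℝ, ∃ N : ℕ, 0 < N ∧ (N : MvPolynomial σ ℝ) - a * a ∈ P :=
    fun a => (harch a).imp fun N hN => ⟨hN.1, hQP hN.2⟩
  choose x hx using fun i => hPm.exists_isInfinitesimalMod_sub hP1
    (IsQuadraticModule.mem_or_neg_mem_of_maximal hP) harchP (X i)
  have hinf : ∀ p : MvPolynomial σ ℝ,
      IsInfinitesimalMod P (p - algebraMap ℝ (MvPolynomial σ ℝ) (eval x p)) := by
    intro p
    induction p using MvPolynomial.induction_on with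
    | C r =>
      intro ε hε
      simpa [algebraMap_eq] using hPm.algebraMap_mem (A := MvPolynomial σ ℝ) hε.le
    | add p q hp hq =>
      convert hp.add hPm hq using 1
      rw [map_add, map_add]; ring
    -- `pXᵢ - p(x)xᵢ = Xᵢ(p - p(x)) + p(x)(Xᵢ - xᵢ)`.
    | mul_X p i hp =>
      convert (hp.mul hPm harchP (X i)).add hPm
        ((hx i).mul hPm harchP (algebraMap ℝ _ (eval x p))) using 1
      rw [map_mul, map_mul, eval_X]; ring
  refine ⟨x, fun q hq => ?_⟩
  by_contra! hlt
  -- With this `ε`, adding `q` to `ε - (q - q(x))` leaves the negative constant `q(x)/2`.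
  obtain ⟨h, -⟩ := hinf q (-(eval x q / 2)) (by linarith)
  refine hPm.algebraMap_notMem hP1 (r := eval x q / 2) (by linarith) ?_
  convert hPm.add_mem (hQP hq) h using 1
  have : algebraMap ℝ (MvPolynomial σ ℝ) (eval x q)
      = algebraMap ℝ _ (eval x q / 2) + algebraMap ℝ _ (eval x q / 2) := by
    rw [← map_add, add_halves]
  rw [map_neg]
  linear_combination -this

/-! ### Matrix polynomials and reduction to scalars -/

namespace MatPoly

variable {n t : ℕ}

theorem quadraticModule_induction {G : Set (MatPoly n t)} {S : MatPoly n t → Prop} (h0 : S 0)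
    (hadd : ∀ a b, S a → S b → S (a + b))
    (hconj : ∀ g ∈ insert 1 G, ∀ p : MatPoly n t, S (p.transpose * g * p)) {q : MatPoly n t}
    (hq : q ∈ quadraticModule G) : S q := by
  obtain ⟨N, g, p, hg, rfl⟩ := hq
  exact Finset.sum_induction _ S hadd h0 fun i _ => hconj _ (hg i) _

theorem zero_mem_quadraticModule (G : Set (MatPoly n t)) : 0 ∈ quadraticModule G :=
  ⟨0, 0, 0, fun i => i.elim0, by simp⟩

theorem conj_mem_quadraticModule {G : Set (MatPoly n t)} {g : MatPoly n t}
    (hg : g ∈ insert 1 G) (p : MatPoly n t) : p.transpose * g * p ∈ quadraticModule G :=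
  ⟨1, fun _ => g, fun _ => p, fun _ => hg, by simp⟩

theorem add_mem_quadraticModule {G : Set (MatPoly n t)} {a b : MatPoly n t}
    (ha : a ∈ quadraticModule G) (hb : b ∈ quadraticModule G) : a + b ∈ quadraticModule G := by
  obtain ⟨N, g, p, hg, rfl⟩ := ha
  obtain ⟨N', g', p', hg', rfl⟩ := hb
  refine ⟨N + N', Fin.append g g', Fin.append p p', fun i => ?_, ?_⟩
  · induction i using Fin.addCases with
    | left i => simpa using hg i
    | right i => simpa using hg' i
  · simp [Fin.sum_univ_add]

theorem conj_mem_quadraticModule_of_mem {G : Set (MatPoly n t)} {a : MatPoly n t}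
    (ha : a ∈ quadraticModule G) (c : MatPoly n t) : c.transpose * a * c ∈ quadraticModule G := by
  refine quadraticModule_induction (S := fun a => c.transpose * a * c ∈ quadraticModule G)
    ?_ ?_ ?_ ha
  · simpa using zero_mem_quadraticModule G
  · intro a b ha hb
    rw [mul_add, add_mul]
    exact add_mem_quadraticModule ha hb
  · intro g hg p
    have := conj_mem_quadraticModule hg (p * c)
    simpa [Matrix.transpose_mul, Matrix.mul_assoc] using this

theorem sum_mem_quadraticModule {G : Set (MatPoly n t)} {ι : Type*} (s : Finset ι)
    {a : ι → MatPoly n t} (ha : ∀ i ∈ s, a i ∈ quadraticModule G) :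
    ∑ i ∈ s, a i ∈ quadraticModule G :=
  Finset.sum_induction a (· ∈ quadraticModule G) (fun _ _ => add_mem_quadraticModule)
    (zero_mem_quadraticModule G) ha

theorem quadraticModule_mono {G H : Set (MatPoly n t)} (h : G ⊆ H) :
    quadraticModule G ⊆ quadraticModule H := by
  rintro q ⟨N, g, p, hg, rfl⟩
  exact ⟨N, g, p, fun i => Set.insert_subset_insert h (hg i), rfl⟩

/-- The scalar matrices in `M_G` form a quadratic module of the polynomial ring. -/
theorem isQuadraticModule_scalar (G : Set (MatPoly n t)) :
    IsQuadraticModule {b | Matrix.scalar (Fin t) b ∈ quadraticModule G} where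
  one_mem := by
    have := conj_mem_quadraticModule (Set.mem_insert 1 G) 1
    simpa using this
  add_mem := by
    intro a b ha hb
    simpa only [Set.mem_ofPred_eq, map_add] using add_mem_quadraticModule ha hb
  sq_mul_mem := by
    intro c a ha
    have := conj_mem_quadraticModule_of_mem ha (Matrix.scalar (Fin t) c)
    simp only [Set.mem_ofPred_eq] at this ⊢
    convert this using 1
    simp [Matrix.scalar_apply, mul_right_comm]

open Matrix in
/-- `M_G` contains the scalar matrices `v^* g v` for vectors `v` of polynomials. -/
theorem scalar_dotProduct_mem {G : Set (MatPoly n t)} {g : MatPoly n t} (hg : g ∈ G)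
    (v : Fin t → MvPolynomial (Fin n) ℝ) :
    Matrix.scalar (Fin t) (v ⬝ᵥ (g *ᵥ v)) ∈ quadraticModule G := by
  -- Conjugating `g` by the rank-one matrix `v eᵢ^*` puts `v^* g v` at diagonal place `i` and zero
  -- elsewhere.
  have : Matrix.scalar (Fin t) (v ⬝ᵥ (g *ᵥ v)) =
      ∑ i, (vecMulVec v (Pi.single i 1)).transpose * g * vecMulVec v (Pi.single i 1) := by
    simp_rw [transpose_vecMulVec, vecMulVec_mul _ v g, vecMulVec_mul_vecMulVec]
    refine Matrix.ext fun i j => ?_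
    simp [Matrix.sum_apply, vecMulVec_apply, Matrix.scalar_apply, Matrix.diagonal_apply,
      Pi.single_apply, dotProduct_mulVec]
  rw [this]
  exact sum_mem_quadraticModule _ fun i _ => conj_mem_quadraticModule (Set.mem_insert_of_mem _ hg) _

open Matrix in
theorem eval_dotProduct_mulVec_C (g : MatPoly n t) (x : Fin n → ℝ) (v : Fin t → ℝ) :
    MvPolynomial.eval x ((fun i => MvPolynomial.C (v i)) ⬝ᵥ (g *ᵥ fun i => MvPolynomial.C (v i)))
      = v ⬝ᵥ (evalAt x g *ᵥ v) := by
  simp [dotProduct, mulVec, evalAt]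

/-- An archimedean quadratic module with empty positivity set contains `-1`. -/
theorem neg_one_mem_quadraticModule {G : Set (MatPoly n t)} (hG : ∀ g ∈ G, g.IsSymm)
    (hM : IsArchimedean (quadraticModule G)) (hS : posSet G = ∅) : -1 ∈ quadraticModule G := by
  by_contra hcon
  obtain ⟨x, hx⟩ := (isQuadraticModule_scalar G).exists_eval_nonneg
    (by simpa only [Set.mem_ofPred_eq, map_neg, map_one] using hcon) (fun a => by
      obtain ⟨N, hN, h⟩ := hM (Matrix.scalar (Fin t) a)
      refine ⟨N, hN, ?_⟩
      simp only [Set.mem_ofPred_eq]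
      convert h using 1
      rw [map_sub, map_natCast, map_mul, Matrix.scalar_apply, Matrix.diagonal_transpose])
  have hmem : x ∈ posSet G := by
    intro g hg
    refine Matrix.PosSemidef.of_dotProduct_mulVec_nonneg ?_ fun v => ?_
    · have := congrArg (evalAt x) (hG g hg)
      simpa [Matrix.IsHermitian, evalAt, Matrix.conjTranspose_eq_transpose_of_trivial,
        Matrix.transpose_map] using this
    · have := hx _ (scalar_dotProduct_mem hg fun i => MvPolynomial.C (v i))
      rw [eval_dotProduct_mulVec_C] at this
      simpa using this
  simp [hS] at hmem

/-- Elements of `M_{G ∪ {-f}}` split off the terms with `-f`. -/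
theorem exists_add_sum_mem_of_mem_insert_neg {G : Set (MatPoly n t)} {f q : MatPoly n t}
    (hq : q ∈ quadraticModule (insert (-f) G)) :
    ∃ (k : ℕ) (p : Fin k → MatPoly n t),
      q + ∑ i, (p i).transpose * f * p i ∈ quadraticModule G := by
  refine quadraticModule_induction (S := fun q => ∃ (k : ℕ) (p : Fin k → MatPoly n t),
      q + ∑ i, (p i).transpose * f * p i ∈ quadraticModule G) ?_ ?_ ?_ hq
  · exact ⟨0, 0, by simpa using zero_mem_quadraticModule G⟩
  · rintro a b ⟨k, p, hp⟩ ⟨k', p', hp'⟩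
    refine ⟨k + k', Fin.append p p', ?_⟩
    convert add_mem_quadraticModule hp hp' using 1
    simp only [Fin.sum_univ_add, Fin.append_left, Fin.append_right]
    abel
  · intro g hg p
    rw [Set.insert_comm] at hg
    rcases hg with rfl | hg
    · exact ⟨1, fun _ => p, by simpa using zero_mem_quadraticModule G⟩
    · exact ⟨0, 0, by simpa using conj_mem_quadraticModule hg p⟩

theorem evalAt_conj (x : Fin n → ℝ) (g p : MatPoly n t) :
    evalAt x (p.transpose * g * p) = (evalAt x p).conjTranspose * evalAt x g * evalAt x p := by
  simp [evalAt, Matrix.map_mul, Matrix.conjTranspose_eq_transpose_of_trivial,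
    Matrix.transpose_map]

theorem evalAt_eq_mapMatrix (x : Fin n → ℝ) (g : MatPoly n t) :
    evalAt x g = (MvPolynomial.eval x).mapMatrix g := rfl

theorem posSemidef_evalAt {G : Set (MatPoly n t)} {x : Fin n → ℝ} (hx : x ∈ posSet G)
    {q : MatPoly n t} (hq : q ∈ quadraticModule G) : (evalAt x q).PosSemidef := by
  refine quadraticModule_induction (S := fun q => (evalAt x q).PosSemidef) ?_ ?_ ?_ hq
  · rw [evalAt_eq_mapMatrix, map_zero]
    exact Matrix.PosSemidef.zero
  · intro a b ha hb
    rw [evalAt_eq_mapMatrix, map_add]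
    exact ha.add hb
  · intro g hg p
    rw [evalAt_conj]
    refine Matrix.PosSemidef.conjTranspose_mul_mul_same ?_ _
    rcases hg with rfl | hg
    · rw [evalAt_eq_mapMatrix, map_one]
      exact Matrix.PosSemidef.one
    · exact hx g hg

end MatPoly

open MatPoly in
theorem corollary21 (n t : ℕ) (ht : 0 < t)
    (G : Set (MatPoly n t)) (hG : ∀ g ∈ G, g.IsSymm)
    (hM : MatPoly.IsArchimedean (MatPoly.quadraticModule G))
    (f : MatPoly n t) (hf : f.IsSymm) :
    (∀ x ∈ MatPoly.posSet G, ¬ (MatPoly.evalAt x f).IsNegSemidef) ↔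
      ∃ (k : ℕ) (p : Fin k → MatPoly n t), ∃ q ∈ MatPoly.quadraticModule G,
        ∑ i, (p i).transpose * f * p i = 1 + q := by
  have evalAt_neg : ∀ x, evalAt x (-f) = -evalAt x f := fun x => by
    simp only [evalAt_eq_mapMatrix, map_neg]
  constructor
  · intro h
    have hmem : -1 ∈ quadraticModule (insert (-f) G) := by
      refine neg_one_mem_quadraticModule ?_ ?_ ?_
      · rintro g (rfl | hg)
        · exact hf.neg
        · exact hG g hg
      · intro a
        obtain ⟨N, hN, ha⟩ := hM a
        exact ⟨N, hN, quadraticModule_mono (Set.subset_insert _ _) ha⟩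
      · refine Set.eq_empty_of_forall_notMem fun x hx => ?_
        refine h x (fun g hg => hx g (Set.mem_insert_of_mem _ hg)) ?_
        have := hx _ (Set.mem_insert _ _)
        rwa [evalAt_neg] at this
    obtain ⟨k, p, hp⟩ := exists_add_sum_mem_of_mem_insert_neg hmem
    exact ⟨k, p, _, hp, by abel⟩
  · rintro ⟨k, p, q, hq, heq⟩ x hx hneg
    have hle : (-(1 + evalAt x q)).PosSemidef := by
      have h : -(1 + evalAt x q) = ∑ i, evalAt x ((p i).transpose * (-f) * p i) := by
        have := congrArg (fun m => -(MvPolynomial.eval x).mapMatrix m) heq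
        simp only [map_add, map_one] at this
        simp only [evalAt_eq_mapMatrix] at *
        rw [← this, ← map_neg, ← map_sum]
        simp
      rw [h]
      refine Matrix.posSemidef_sum _ fun i _ => ?_
      rw [evalAt_conj, evalAt_neg]
      exact Matrix.PosSemidef.conjTranspose_mul_mul_same hneg _
    -- The sum is `-1`, whose diagonal is negative; `0 < t` supplies an entry.
    have h := (hle.add (posSemidef_evalAt hx hq)).diag_nonneg (i := ⟨0, ht⟩)
    simp at h
    linarith
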